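/- A permutation is an ordering $\pi=\pi_1\cdots\pi_n$ of a finite set of positive integers, and $S_n$ is the set of orderings of $\{1,\ldots,n\}$. Let $\operatorname{des}(\pi)$ be the number of descents of $\pi$ (indices $i\in\{1,\ldots,n-1\}$ with $\pi_i>\pi_{i+1}$) and $\operatorname{peak}(\pi)$ the number of peaks of $\pi$ (indices $i\in\{2,\ldots,n-1\}$ with $\pi_{i-1}<\pi_i>\pi_{i+1}$). The stack-sorting map $s$ is defined by the following procedure, which starts with an empty stack and the input $\pi$. If there is a next input entry and the stack is empty or the next input entry is smaller than the entry at the top of the stack, push the next input entry onto the stack; otherwise, remove the top entry of the stack and append it to the output. Stop when the output has length $n$; then $s(\pi)$ is the output. For a set $A$ of permutations, $s^{-1}(A)$ is the set of permutations $\sigma$ with $s(\sigma)\in A$. A polynomial $p(x)=a_0+a_1x+\cdots+a_dx^d$ with nonnegative real coefficients (where $a_d=0$ is allowed) is symmetric with center of symmetry $d/2$ if $a_i=a_{d-i}$ for $0\le i\le d$. Such a polynomial can be written uniquely as $p(x)=\sum_{m=0}^{\lfloor d/2\rfloor}\gamma_m x^m(1+x)^{d-2m}$ with real $\gamma_m$,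 and it is called $\gamma$-nonnegative (with center of symmetry $d/2$) if all $\gamma_m$ are nonnegative. **Theorem (Brändén).** Let $n\ge 1$ and $A\subseteq S_n$. Then \[\sum_{\sigma\in s^{-1}(A)}x^{\operatorname{des}(\sigma)}=\sum_{m=0}^{\lfloor (n-1)/2\rfloor}\frac{|\{\sigma\in s^{-1}(A):\operatorname{peak}(\sigma)=m\}|}{2^{n-1-2m}}\,x^m(1+x)^{n-1-2m}.\] In particular, the polynomial $\sum_{\sigma\in s^{-1}(A)}x^{\operatorname{des}(\sigma)}$ is $\gamma$-nonnegative, with center of symmetry $(n-1)/2$. -/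

import Mathlib

open Polynomial

namespace StackSorting

/-- The stack-sorting procedure, as a function of the current stack (top entry first) and of the
remaining input; the value is the list of the entries that are still to be output, in order.
If there is a next input entry and the stack is empty or its top is larger than that entry, then
the entry is pushed. Otherwise the top of the stack is popped to the output. -/
def run : List ℕ → List ℕ → List ℕ
  | [], [] => []
  | [], x :: xs => run [x] xs
  | t :: st, [] => t :: run st []
  | t :: st, x :: xs => if x < t then run (x :: t :: st) xs else t :: run st (x :: xs)
termination_by st inp => 2 * inp.length + st.length

/-- The stack-sorting map on permutations in one-line notation. -/
def stackSort (σ : List ℕ) : List ℕ := run [] σ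

/-- `S n`: the orderings of `1, …, n`, in one-line notation. -/
def S (n : ℕ) : Finset (List ℕ) := (List.range' 1 n).permutations.toFinset

/-- The number of descents, i.e. of consecutive entries `a, b` with `a > b`. -/
def des : List ℕ → ℕ
  | a :: b :: l => (if b < a then 1 else 0) + des (b :: l)
  | _ => 0

/-- The number of peaks, i.e. of consecutive entries `a, b, c` with `a < b > c`. -/
def peak : List ℕ → ℕ
  | a :: b :: c :: l => (if a < b ∧ c < b then 1 else 0) + peak (b :: c :: l)
  | _ => 0

/-- The preimage of `A ⊆ S n` under the stack-sorting map. Restricting to `S n` loses nothing,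
see `mem_preimage_iff`. -/
def preimage (n : ℕ) (A : Finset (List ℕ)) : Finset (List ℕ) :=
  (S n).filter fun σ => stackSort σ ∈ A

theorem mem_S {n : ℕ} {σ : List ℕ} : σ ∈ S n ↔ σ.Perm (List.range' 1 n) := by
  simp [S]

theorem run_perm (st inp : List ℕ) : (run st inp).Perm (st ++ inp) := by
  fun_induction run st inp with
  | case1 => simp
  | case2 x xs ih => simpa using ih
  | case3 t st ih => simpa using ih
  | case4 t st x xs h ih =>
    exact ih.trans (by simpa using (List.perm_middle (a := x) (l₁ := t :: st) (l₂ := xs)).symm)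
  | case5 t st x xs h ih => simpa using ih

theorem stackSort_perm (σ : List ℕ) : (stackSort σ).Perm σ := by
  simpa [stackSort] using run_perm [] σ

theorem mem_preimage_iff {n : ℕ} {A : Finset (List ℕ)} (hA : A ⊆ S n) (σ : List ℕ) :
    σ ∈ preimage n A ↔ stackSort σ ∈ A := by
  rw [preimage, Finset.mem_filter, and_iff_right_iff_imp]
  intro h
  exact mem_S.2 ((stackSort_perm σ).symm.trans (mem_S.1 (hA h)))

/-- `p = a₀ + a₁ x + ⋯ + a_d x ^ d` has nonnegative coefficients with `a_i = a_{d - i}`, i.e. it is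
symmetric with center of symmetry `d / 2`. -/
def IsSymmetric (p : ℝ[X]) (d : ℕ) : Prop :=
  (∀ i, 0 ≤ p.coeff i) ∧ p.natDegree ≤ d ∧ ∀ i ≤ d, p.coeff i = p.coeff (d - i)

/-- `p` is symmetric with center of symmetry `d / 2`, and the coefficients `γ m` in its expansion
in the polynomials `x ^ m (1 + x) ^ (d - 2m)`, `0 ≤ m ≤ d / 2`, are nonnegative. -/
def IsGammaNonneg (p : ℝ[X]) (d : ℕ) : Prop :=
  IsSymmetric p d ∧ ∃ γ : ℕ → ℝ, (∀ m, 0 ≤ γ m) ∧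
    p = ∑ m ∈ Finset.range (d / 2 + 1), C (γ m) * X ^ m * (1 + X) ^ (d - 2 * m)

end StackSorting

/-! ### Stack-sorting around the maximum -/

namespace StackSorting

/-! Split a permutation at its maximum, σ = L n R; then s(σ) = s(L) s(R) n. So the fiber over w n is
the union, over all splittings w = u v, of fiber(u) × fiber(v), and it suffices to treat single
fibers, by induction on length. Compare x^des with `peakWeight`, which is x^peak ((1+x)/2)^(length -
1 - 2 peak). If u and v are nonempty, inserting n multiplies both by x. The two extreme splittings
both run over fiber(w): n in front or at the end gives x^des the factors x and 1, and gives
`peakWeight` the factor (1+x)/2 twice. Both pairs add up to 1 + x, so the sums agree fiber by fiber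
(`sum_fiber_X_pow_des`), although single terms do not. Summing over A and grouping by peaks gives
the formula. -/

theorem run_append_singleton (n : ℕ) (st inp : List ℕ) (h : ∀ x ∈ inp, x < n) :
    run (st ++ [n]) inp = run st inp ++ [n] := by
  fun_induction run st inp with
  | case1 => simp [run]
  | case2 x xs ih =>
    have hx : x < n := h x (by simp)
    have := ih fun y hy => h y (by simp [hy])
    simpa [run, hx] using this
  | case3 t st ih => simpa [run] using ih (by simp)
  | case4 t st x xs hx ih =>
    have := ih fun y hy => h y (by simp [hy])
    simpa [run, hx] using this
  | case5 t st x xs hx ih => simpa [run, hx] using ih h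

/-- Everything on the stack is smaller than `n`, so it is popped before `n` is pushed, and `n`
enters an empty stack. -/
theorem run_append_cons (n : ℕ) (R st L : List ℕ) (hst : ∀ x ∈ st, x < n) (hL : ∀ x ∈ L, x < n) :
    run st (L ++ n :: R) = run st L ++ run [n] R := by
  fun_induction run st L with
  | case1 => simp [run]
  | case2 x xs ih =>
    have := ih (by simpa using hL x (by simp)) fun y hy => hL y (by simp [hy])
    simpa [run] using this
  | case3 t st ih =>
    have ht : ¬ n < t := (hst t (by simp)).not_gt
    have := ih (fun y hy => hst y (by simp [hy])) hL
    simpa [run, ht] using this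
  | case4 t st x xs hx ih =>
    have := ih (by simpa using ⟨hL x (by simp), hst t (by simp), fun y hy => hst y (by simp [hy])⟩)
      fun y hy => hL y (by simp [hy])
    simpa [run, hx] using this
  | case5 t st x xs hx ih =>
    have := ih (fun y hy => hst y (by simp [hy])) hL
    simpa [run, hx] using this

/-- The recursive description of the stack-sorting map. -/
theorem stackSort_append_cons {n : ℕ} {L R : List ℕ} (hL : ∀ x ∈ L, x < n)
    (hR : ∀ x ∈ R, x < n) :
    stackSort (L ++ n :: R) = stackSort L ++ stackSort R ++ [n] := by
  rw [stackSort, run_append_cons n R [] L (by simp) hL]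
  have := run_append_singleton n [] R hR
  simp only [List.nil_append] at this
  rw [this, stackSort, stackSort, List.append_assoc]

/-! ### Descents and peaks around the maximum -/

theorem des_append_cons {n : ℕ} {L R : List ℕ} (hL : ∀ x ∈ L, x < n) (hR : ∀ x ∈ R, x < n) :
    des (L ++ n :: R) = des L + des R + if R = [] then 0 else 1 := by
  fun_induction des L with
  | case1 a b l ih =>
    have := ih fun y hy => hL y (by simp [hy])
    simp only [List.cons_append, des] at this ⊢
    omega
  | case2 L h =>
    have hn : des (n :: R) = des R + if R = [] then 0 else 1 := by
      cases R with
      | nil => simp [des]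
      | cons r R => simp [des, hR r (by simp), add_comm]
    match L, h with
    | [], _ => simpa using hn
    | [a], _ => simpa [des, (hL a (by simp)).not_gt] using hn
    | a :: b :: l, h => exact (h a b l rfl).elim

theorem peak_cons_of_forall_lt {n : ℕ} {R : List ℕ} (hR : ∀ x ∈ R, x < n) :
    peak (n :: R) = peak R := by
  match R with
  | [] | [_] => simp [peak]
  | r :: r' :: R => simp [peak, (hR r (by simp)).le]

theorem peak_append_cons {n : ℕ} {L R : List ℕ} (hL : ∀ x ∈ L, x < n) (hR : ∀ x ∈ R, x < n) :
    peak (L ++ n :: R) = peak L + peak R + if L = [] ∨ R = [] then 0 else 1 := by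
  have hn := peak_cons_of_forall_lt hR
  fun_induction peak L with
  | case1 a b c l ih =>
    have := ih fun y hy => hL y (by simp [hy])
    simp only [List.cons_append, peak] at this ⊢
    simp only [reduceCtorEq, false_or] at this ⊢
    omega
  | case2 L h =>
    have h1 (a : ℕ) (ha : a < n) : peak (a :: n :: R) = peak R + if R = [] then 0 else 1 := by
      cases R with
      | nil => simp [peak]
      | cons r R =>
        rw [← hn]
        simp [peak, hR r (by simp), ha, add_comm]
    match L, h with
    | [], _ => simpa using hn
    | [a], _ => simpa using h1 a (hL a (by simp))
    | [a, b], _ =>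
      simpa [peak, (hL b (by simp)).not_gt] using h1 b (hL b (by simp))
    | a :: b :: c :: l, h => exact (h a b c l rfl).elim

theorem des_lt_length {l : List ℕ} (hl : l ≠ []) : des l < l.length := by
  fun_induction des l with
  | case1 a b l ih =>
    have := ih (by simp)
    simp only [List.length_cons] at this ⊢
    split <;> omega
  | case2 l h => exact List.length_pos_iff.2 hl

/-- Peaks are never adjacent. The descent term strengthens the induction: a peak at `b` forces a
descent at the start of the tail, which pays for the second unit. -/
theorem two_mul_peak_cons_cons (a b : ℕ) (l : List ℕ) :
    2 * peak (a :: b :: l) + (if b < a then 1 else 0) + 1 ≤ l.length + 2 := by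
  induction l generalizing a b with
  | nil => simp only [peak, List.length_nil]; split <;> omega
  | cons c l ih =>
    have := ih b c
    simp only [peak, List.length_cons] at this ⊢
    split_ifs at this ⊢ <;> omega

/-- Makes the truncated subtraction in the exponent of `peakWeight` exact for nonempty lists. -/
theorem two_mul_peak_lt_length {l : List ℕ} (hl : l ≠ []) : 2 * peak l < l.length := by
  match l with
  | [_] => simp [peak]
  | a :: b :: l =>
    have := two_mul_peak_cons_cons a b l
    simp only [List.length_cons]
    omega

/-! ### Peak weights -/

/-- The average of `X ^ des` over the orbit of `σ` under valley hopping. -/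
noncomputable def peakWeight (σ : List ℕ) : ℝ[X] :=
  X ^ peak σ * (C (1 / 2) * (1 + X)) ^ (σ.length - 1 - 2 * peak σ)

theorem peakWeight_append_cons {n : ℕ} {L R : List ℕ} (hL : ∀ x ∈ L, x < n)
    (hR : ∀ x ∈ R, x < n) (hL' : L ≠ []) (hR' : R ≠ []) :
    peakWeight (L ++ n :: R) = X * (peakWeight L * peakWeight R) := by
  have h1 := two_mul_peak_lt_length hL'
  have h2 := two_mul_peak_lt_length hR'
  have h3 : (L ++ n :: R).length - 1 - 2 * (peak L + peak R + 1)
      = (L.length - 1 - 2 * peak L) + (R.length - 1 - 2 * peak R) := by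
    simp only [List.length_append, List.length_cons]
    omega
  rw [peakWeight, peak_append_cons hL hR, if_neg (by simp [hL', hR']), h3, peakWeight, peakWeight]
  ring

theorem peakWeight_cons {n : ℕ} {R : List ℕ} (hR : ∀ x ∈ R, x < n) (hR' : R ≠ []) :
    peakWeight (n :: R) = C (1 / 2) * (1 + X) * peakWeight R := by
  have h2 := two_mul_peak_lt_length hR'
  have h3 : (n :: R).length - 1 - 2 * peak R = (R.length - 1 - 2 * peak R) + 1 := by
    simp only [List.length_cons]
    omega
  rw [peakWeight, peak_cons_of_forall_lt hR, h3, peakWeight]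
  ring

theorem peakWeight_concat {n : ℕ} {L : List ℕ} (hL : ∀ x ∈ L, x < n) (hL' : L ≠ []) :
    peakWeight (L ++ [n]) = C (1 / 2) * (1 + X) * peakWeight L := by
  have h2 := two_mul_peak_lt_length hL'
  have h3 : (L ++ [n]).length - 1 - 2 * peak L = (L.length - 1 - 2 * peak L) + 1 := by
    simp only [List.length_append, List.length_cons, List.length_nil]
    omega
  rw [peakWeight, peak_append_cons hL (by simp), if_pos (by simp),
    show peak L + peak [] + 0 = peak L by simp [peak], h3, peakWeight]
  ring

/-! ### Fibers of the stack-sorting map -/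

/-- The permutations with a given image under the stack-sorting map. -/
def fiber (w : List ℕ) : Finset (List ℕ) :=
  w.permutations.toFinset.filter fun σ => stackSort σ = w

theorem mem_fiber {w σ : List ℕ} : σ ∈ fiber w ↔ stackSort σ = w := by
  simp only [fiber, Finset.mem_filter, List.mem_toFinset, List.mem_permutations,
    and_iff_right_iff_imp]
  rintro rfl
  exact (stackSort_perm σ).symm

theorem perm_of_mem_fiber {w σ : List ℕ} (h : σ ∈ fiber w) : σ.Perm w :=
  mem_fiber.1 h ▸ (stackSort_perm σ).symm

/-- A nonempty list without repetitions splits at its maximum. -/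
theorem exists_eq_append_max_cons {σ : List ℕ} (hσ : σ.Nodup) (h : σ ≠ []) :
    ∃ L n R, σ = L ++ n :: R ∧ (∀ x ∈ L, x < n) ∧ ∀ x ∈ R, x < n := by
  obtain ⟨n, hn, hmax⟩ := σ.toFinset.exists_max_image id (by simpa using h)
  simp only [List.mem_toFinset, id] at hn hmax
  obtain ⟨L, R, rfl⟩ := List.append_of_mem hn
  have h1 := List.nodup_middle.1 hσ
  simp only [List.nodup_cons, List.mem_append, not_or] at h1
  refine ⟨L, n, R, rfl, fun x hx => ?_, fun x hx => ?_⟩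
  · exact lt_of_le_of_ne (hmax x (by simp [hx])) fun e => h1.1.1 (e ▸ hx)
  · exact lt_of_le_of_ne (hmax x (by simp [hx])) fun e => h1.1.2 (e ▸ hx)

theorem exists_eq_append_cons_of_stackSort_eq_concat {σ w : List ℕ} {n : ℕ} (hσ : σ.Nodup)
    (h : stackSort σ = w ++ [n]) :
    ∃ L R, σ = L ++ n :: R ∧ (∀ x ∈ L, x < n) ∧ (∀ x ∈ R, x < n) ∧
      stackSort L ++ stackSort R = w := by
  have hne : σ ≠ [] := by
    rintro rfl
    simp [stackSort, run] at h
  obtain ⟨L, m, R, rfl, hL, hR⟩ := exists_eq_append_max_cons hσ hne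
  rw [stackSort_append_cons hL hR] at h
  obtain ⟨h1, h2⟩ := List.append_inj' h rfl
  obtain rfl : m = n := by simpa using h2
  exact ⟨L, R, rfl, hL, hR, h1⟩

/-- A permutation with image `w n` consists of a permutation whose image is an initial segment of
`w`, then `n`, then a permutation whose image is the rest of `w`. -/
theorem sum_fiber_concat {M : Type*} [AddCommMonoid M] {w : List ℕ} {n : ℕ} (hw : w.Nodup)
    (hn : ∀ x ∈ w, x < n) (f : List ℕ → M) :
    ∑ σ ∈ fiber (w ++ [n]), f σ = ∑ i ∈ Finset.range (w.length + 1),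
      ∑ p ∈ fiber (w.take i) ×ˢ fiber (w.drop i), f (p.1 ++ n :: p.2) := by
  rw [Finset.sum_sigma']
  symm
  have hlt {i : ℕ} {p : List ℕ × List ℕ} (hp : p ∈ fiber (w.take i) ×ˢ fiber (w.drop i)) :
      (∀ x ∈ p.1, x < n) ∧ ∀ x ∈ p.2, x < n := by
    rw [Finset.mem_product] at hp
    exact ⟨fun x hx => hn x (List.mem_of_mem_take ((perm_of_mem_fiber hp.1).mem_iff.1 hx)),
      fun x hx => hn x (List.mem_of_mem_drop ((perm_of_mem_fiber hp.2).mem_iff.1 hx))⟩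
  refine Finset.sum_bij (fun a _ => a.2.1 ++ n :: a.2.2) ?_ ?_ ?_ fun _ _ => rfl
  · rintro ⟨i, p⟩ h
    have hp := (Finset.mem_sigma.1 h).2
    obtain ⟨h1, h2⟩ := hlt hp
    rw [Finset.mem_product, mem_fiber, mem_fiber] at hp
    rw [mem_fiber, stackSort_append_cons h1 h2, hp.1, hp.2, List.take_append_drop]
  · rintro ⟨i, p⟩ hi ⟨j, q⟩ hj e
    rw [Finset.mem_sigma] at hi hj
    have hp := hlt hi.2
    have hp1 := (perm_of_mem_fiber (Finset.mem_product.1 hi.2).1).length_eq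
    have hq1 := (perm_of_mem_fiber (Finset.mem_product.1 hj.2).1).length_eq
    have hi1 := Finset.mem_range.1 hi.1
    have hj1 := Finset.mem_range.1 hj.1
    simp only [List.length_take] at hp1 hq1 hi1 hj1
    obtain ⟨e1, -, e2⟩ := (List.append_cons_inj_of_notMem
      (fun h => (hp.1 n h).false) (fun h => (hp.2 n h).false)).1 e
    -- The cut position is the length of the part before `n`.
    have hij : i = j := by
      have : p.1.length = q.1.length := congrArg List.length e1
      omega
    subst hij
    obtain rfl : p = q := Prod.ext e1 e2
    rfl
  · intro σ hσ
    have hnd : σ.Nodup := (perm_of_mem_fiber hσ).nodup_iff.2 (by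
      rw [← List.concat_eq_append]
      exact hw.concat fun h => (hn n h).false)
    obtain ⟨L, R, rfl, -, -, h⟩ := exists_eq_append_cons_of_stackSort_eq_concat hnd
      (mem_fiber.1 hσ)
    refine ⟨⟨(stackSort L).length, L, R⟩, ?_, rfl⟩
    subst h
    simp only [Finset.mem_sigma, Finset.mem_range, Finset.mem_product, mem_fiber, List.length_append,
      List.take_left, List.drop_left, and_true]
    omega

/-- Stack-sorting always outputs the maximum last. -/
theorem fiber_concat_eq_empty {w : List ℕ} {n : ℕ} (hw : (w ++ [n]).Nodup)
    (hn : ¬ ∀ x ∈ w, x < n) : fiber (w ++ [n]) = ∅ := by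
  refine Finset.eq_empty_of_forall_notMem fun σ hσ => hn ?_
  obtain ⟨L, R, -, hL, hR, rfl⟩ := exists_eq_append_cons_of_stackSort_eq_concat
    ((perm_of_mem_fiber hσ).nodup_iff.2 hw) (mem_fiber.1 hσ)
  intro x hx
  rcases List.mem_append.1 hx with hx | hx
  · exact hL x ((stackSort_perm L).mem_iff.1 hx)
  · exact hR x ((stackSort_perm R).mem_iff.1 hx)

theorem fiber_nil : fiber [] = {[]} := by
  ext σ
  rw [Finset.mem_singleton]
  refine ⟨fun h => (perm_of_mem_fiber h).eq_nil, ?_⟩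
  rintro rfl
  simp [mem_fiber, stackSort, run]

theorem ne_nil_of_mem_fiber {w σ : List ℕ} (h : σ ∈ fiber w) (hw : w ≠ []) : σ ≠ [] := by
  rintro rfl
  exact hw (perm_of_mem_fiber h).nil_eq.symm

/-! ### Equality of the two sums on each fiber -/

theorem sum_fiber_X_pow_des (w : List ℕ) (hw : w.Nodup) :
    ∑ σ ∈ fiber w, (X : ℝ[X]) ^ des σ = ∑ σ ∈ fiber w, peakWeight σ := by
  induction hk : w.length using Nat.strong_induction_on generalizing w with
  | _ k ih =>
  obtain rfl | ⟨w, n, rfl⟩ := w.eq_nil_or_concat'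
  -- For the empty list the exponent `0 - 1 - 0` truncates to 0, so both sides are 1.
  · simp [fiber_nil, des, peakWeight, peak]
  by_cases hn : ∀ x ∈ w, x < n
  swap
  · simp [fiber_concat_eq_empty hw hn]
  have hwnd : w.Nodup := hw.of_append_left
  have hlen : w.length < k := by simp [← hk]
  rw [sum_fiber_concat hwnd hn, sum_fiber_concat hwnd hn]
  -- For empty `w` the two extreme splittings coincide.
  by_cases hw0 : w = []
  · subst hw0
    simp [fiber_nil, des, peakWeight, peak]
  have hmem {v σ : List ℕ} (hv : v ⊆ w) (h : σ ∈ fiber v) : ∀ x ∈ σ, x < n :=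
    fun x hx => hn x (hv ((perm_of_mem_fiber h).mem_iff.1 hx))
  obtain ⟨l, hl⟩ : ∃ l, w.length = l + 1 :=
    Nat.exists_eq_succ_of_ne_zero (by simpa using hw0)
  -- Detach the extreme splittings, where one side is empty: only their combined contributions
  -- agree.
  rw [Finset.sum_range_succ, Finset.sum_range_succ, hl, Finset.sum_range_succ',
    Finset.sum_range_succ', add_assoc, add_assoc]
  congr 1
  · refine Finset.sum_congr rfl fun i hi => ?_
    have hi := Finset.mem_range.1 hi
    have e1 : w.take (i + 1) ≠ [] := by simp [hw0]
    have e2 : w.drop (i + 1) ≠ [] := by simp; omega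
    have s1 := ih _ (by simp; omega) (w.take (i + 1)) (hwnd.sublist (List.take_sublist _ _)) rfl
    have s2 := ih _ (by simp; omega) (w.drop (i + 1)) (hwnd.sublist (List.drop_sublist _ _)) rfl
    have a1 : ∀ p ∈ fiber (w.take (i + 1)) ×ˢ fiber (w.drop (i + 1)),
        (X : ℝ[X]) ^ des (p.1 ++ n :: p.2) = X * (X ^ des p.1 * X ^ des p.2) := by
      intro p hp
      rw [Finset.mem_product] at hp
      rw [des_append_cons (hmem (List.take_subset _ _) hp.1) (hmem (List.drop_subset _ _) hp.2),
        if_neg (ne_nil_of_mem_fiber hp.2 e2)]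
      ring
    have a2 : ∀ p ∈ fiber (w.take (i + 1)) ×ˢ fiber (w.drop (i + 1)),
        peakWeight (p.1 ++ n :: p.2) = X * (peakWeight p.1 * peakWeight p.2) := by
      intro p hp
      rw [Finset.mem_product] at hp
      exact peakWeight_append_cons (hmem (List.take_subset _ _) hp.1)
        (hmem (List.drop_subset _ _) hp.2) (ne_nil_of_mem_fiber hp.1 e1)
        (ne_nil_of_mem_fiber hp.2 e2)
    rw [Finset.sum_congr rfl a1, Finset.sum_congr rfl a2, ← Finset.mul_sum, ← Finset.mul_sum]
    simp only [Finset.sum_product]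
    rw [← Finset.sum_mul_sum, ← Finset.sum_mul_sum, s1, s2]
  · rw [← hl]
    simp only [List.take_zero, List.drop_zero, List.take_length, List.drop_length, fiber_nil,
      Finset.singleton_product, Finset.product_singleton, Finset.sum_map,
      Function.Embedding.coeFn_mk, List.nil_append]
    have s := ih _ hlen w hwnd rfl
    have hm {σ : List ℕ} (h : σ ∈ fiber w) : ∀ x ∈ σ, x < n := hmem (List.Subset.refl w) h
    have d1 : ∀ σ ∈ fiber w, (X : ℝ[X]) ^ des (n :: σ) = X * X ^ des σ := fun σ h => by
      have := des_append_cons (L := []) (by simp) (hm h)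
      rw [List.nil_append, if_neg (ne_nil_of_mem_fiber h hw0)] at this
      rw [this, des.eq_2 [] (by simp)]
      ring
    have d2 : ∀ σ ∈ fiber w, (X : ℝ[X]) ^ des (σ ++ [n]) = X ^ des σ := fun σ h => by
      rw [des_append_cons (hm h) (by simp)]
      simp [des]
    have p1 : ∀ σ ∈ fiber w, peakWeight (n :: σ) = C (1 / 2) * (1 + X) * peakWeight σ :=
      fun σ h => peakWeight_cons (hm h) (ne_nil_of_mem_fiber h hw0)
    have p2 : ∀ σ ∈ fiber w, peakWeight (σ ++ [n]) = C (1 / 2) * (1 + X) * peakWeight σ :=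
      fun σ h => peakWeight_concat (hm h) (ne_nil_of_mem_fiber h hw0)
    rw [Finset.sum_congr rfl d1, Finset.sum_congr rfl d2, Finset.sum_congr rfl p1,
      Finset.sum_congr rfl p2, ← Finset.mul_sum, ← Finset.mul_sum, s]
    have hC : (C (1 / 2) : ℝ[X]) * 2 = 1 := by
      rw [← C_ofNat, ← C_mul]
      norm_num
    -- The factors `1` and `X` balance two copies of `(1 + X) / 2`.
    linear_combination (-(1 + X) * ∑ σ ∈ fiber w, peakWeight σ) * hC

/-! ### From fibers to preimages, and symmetry -/

theorem sum_preimage_eq_sum_fiber {M : Type*} [AddCommMonoid M] {n : ℕ} {A : Finset (List ℕ)}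
    (hA : A ⊆ S n) (f : List ℕ → M) :
    ∑ σ ∈ preimage n A, f σ = ∑ w ∈ A, ∑ σ ∈ fiber w, f σ := by
  rw [← Finset.sum_fiberwise_of_maps_to (g := stackSort) (t := A)
    fun σ h => (mem_preimage_iff hA σ).1 h]
  refine Finset.sum_congr rfl fun w hw => Finset.sum_congr ?_ fun _ _ => rfl
  ext σ
  rw [Finset.mem_filter, mem_preimage_iff hA, mem_fiber, and_iff_right_iff_imp]
  rintro rfl
  exact hw

theorem length_of_mem_preimage {n : ℕ} {A : Finset (List ℕ)} {σ : List ℕ}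
    (h : σ ∈ preimage n A) : σ.length = n := by
  simpa using (mem_S.1 (Finset.mem_filter.1 h).1).length_eq

theorem sum_preimage_X_pow_des {n : ℕ} (hn : 1 ≤ n) {A : Finset (List ℕ)} (hA : A ⊆ S n) :
    ∑ σ ∈ preimage n A, (X : ℝ[X]) ^ des σ
      = ∑ m ∈ Finset.range ((n - 1) / 2 + 1),
          C ((((preimage n A).filter fun σ => peak σ = m).card : ℝ) / 2 ^ (n - 1 - 2 * m))
            * X ^ m * (1 + X) ^ (n - 1 - 2 * m) := by
  rw [sum_preimage_eq_sum_fiber hA, Finset.sum_congr rfl fun w hw =>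
    sum_fiber_X_pow_des w ((mem_S.1 (hA hw)).nodup_iff.2 (List.nodup_range' (step := 1))),
    ← sum_preimage_eq_sum_fiber hA,
    ← Finset.sum_fiberwise_of_maps_to (g := peak) (t := Finset.range ((n - 1) / 2 + 1))]
  · refine Finset.sum_congr rfl fun m _ => ?_
    have h : ∀ σ ∈ (preimage n A).filter fun σ => peak σ = m,
        peakWeight σ = X ^ m * (C (1 / 2) * (1 + X)) ^ (n - 1 - 2 * m) := fun σ hσ => by
      rw [Finset.mem_filter] at hσ
      rw [peakWeight, hσ.2, length_of_mem_preimage hσ.1]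
    rw [Finset.sum_congr rfl h, Finset.sum_const, nsmul_eq_mul, mul_pow, ← C_pow, one_div_pow,
      div_eq_mul_one_div (Nat.cast _ : ℝ), C_mul, map_natCast]
    ring
  · intro σ hσ
    have h1 := length_of_mem_preimage hσ
    have h2 := two_mul_peak_lt_length (l := σ) (by rintro rfl; simp at h1; omega)
    rw [Finset.mem_range]
    omega

theorem coeff_X_pow_mul_one_add_X_pow_symm {R : Type*} [CommSemiring R] {d m i : ℕ}
    (hm : 2 * m ≤ d) (hi : i ≤ d) :
    ((X : R[X]) ^ m * (1 + X) ^ (d - 2 * m)).coeff i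
      = ((X : R[X]) ^ m * (1 + X) ^ (d - 2 * m)).coeff (d - i) := by
  simp only [coeff_X_pow_mul', coeff_one_add_X_pow]
  by_cases h1 : m ≤ i <;> by_cases h2 : m ≤ d - i
  · rw [if_pos h1, if_pos h2, ← Nat.choose_symm (by omega)]
    congr 2
    omega
  -- Here `d - i < m` gives `i - m > d - 2 * m`, so the binomial coefficient vanishes.
  · rw [if_pos h1, if_neg h2, Nat.choose_eq_zero_of_lt (by omega), Nat.cast_zero]
  · rw [if_neg h1, if_pos h2, Nat.choose_eq_zero_of_lt (by omega), Nat.cast_zero]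
  · rw [if_neg h1, if_neg h2]

end StackSorting

theorem mainTheorem10 (n : ℕ) (hn : 1 ≤ n) (A : Finset (List ℕ)) (hA : A ⊆ StackSorting.S n) :
    (∑ σ ∈ StackSorting.preimage n A, (X : ℝ[X]) ^ StackSorting.des σ
      = ∑ m ∈ Finset.range ((n - 1) / 2 + 1),
          C ((((StackSorting.preimage n A).filter fun σ => StackSorting.peak σ = m).card : ℝ)
              / 2 ^ (n - 1 - 2 * m)) * X ^ m * (1 + X) ^ (n - 1 - 2 * m)) ∧
    StackSorting.IsGammaNonneg
      (∑ σ ∈ StackSorting.preimage n A, (X : ℝ[X]) ^ StackSorting.des σ) (n - 1) := by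
  have key := StackSorting.sum_preimage_X_pow_des hn hA
  -- The coefficients γ are read off from `key`.
  refine ⟨key, ⟨fun i => ?_, ?_, fun i hi => ?_⟩, _, fun m => ?_, key⟩
  · rw [finsetSum_coeff]
    refine Finset.sum_nonneg fun σ _ => ?_
    rw [coeff_X_pow]
    split <;> simp
  · refine natDegree_sum_le_of_forall_le _ _ fun σ hσ => ?_
    have h1 := StackSorting.length_of_mem_preimage hσ
    have h2 := StackSorting.des_lt_length (l := σ) (by rintro rfl; simp at h1; omega)
    rw [natDegree_X_pow]
    omega
  · rw [key, finsetSum_coeff, finsetSum_coeff]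
    refine Finset.sum_congr rfl fun m hm => ?_
    rw [Finset.mem_range] at hm
    rw [mul_assoc, coeff_C_mul, coeff_C_mul,
      StackSorting.coeff_X_pow_mul_one_add_X_pow_symm (by omega) hi]
  · positivity
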